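/- Let $\Gamma$ be the quotient of the polynomial ring $\mathbb{Z}[c_1,c_2,\ldots]$ by the ideal generated by the elements \[ c_p^2+2\sum_{i=1}^p(-1)^i c_{p+i}c_{p-i}, \qquad p\geq 1, \] where $c_0:=1$. For an integer $n\geq 0$ let $X_n=(x_1,\ldots,x_n)$ be commuting independent variables, and let $e_j(X_n)$ denote the $j$-th elementary symmetric polynomial in $x_1,\ldots,x_n$ (so $e_0=1$, and $e_j(X_n)=0$ for $j>n$). For $p\geq 1$ set \[ {}^nc_p:=\sum_{j=0}^p c_{p-j}\,e_j(X_n)\in\Gamma[X_n], \] and let $\Gamma^{(n)}:=\mathbb{Z}[{}^nc_1,{}^nc_2,\ldots]$ be the subring of $\Gamma[X_n]$ generated by these elements. Let $\mathcal{P}_n$ be the set of strict partitions $\lambda=(\lambda_1>\cdots>\lambda_\ell>0)$, $\ell\geq 0$, all of whose parts are at most $n$ (including the empty partition), and for $\lambda\in\mathcal{P}_n$ put $e_\lambda(-X_n):=\prod_{i=1}^{\ell}e_{\lambda_i}(-x_1,\ldots,-x_n)$. Then $\Gamma[X_n]$ is a free $\Gamma^{(n)}$-module of rank $2^n\,n!$,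 and the products \[ e_\lambda(-X_n)\,x_1^{\alpha_1}\cdots x_n^{\alpha_n},\qquad \lambda\in\mathcal{P}_n,\quad \alpha\in\mathbb{Z}^n,\quad 0\leq\alpha_i\leq n-i \text{ for } 1\leq i\leq n, \] indexed by the pairs $(\lambda,\alpha)$, form a basis of it. -/

import Mathlib

noncomputable section

namespace SchubertC

/-- The variables `c_p` of `ℤ[c] = ℤ[c_1, c_2, …]`, with the convention `c_0 = 1`. -/
def cVar (p : ℕ) : MvPolynomial ℕ+ ℤ :=
  if h : 0 < p then MvPolynomial.X ⟨p, h⟩ else 1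

/-- The polynomial `c_p ^ 2 + 2 ∑_{i=1}^p (-1)^i c_{p+i} c_{p-i}`. -/
def basicRel (p : ℕ) : MvPolynomial ℕ+ ℤ :=
  cVar p ^ 2 + 2 * ∑ i ∈ Finset.Icc 1 p, (-1) ^ i * (cVar (p + i) * cVar (p - i))

/-- The ideal of `ℤ[c]` generated by the polynomials `basicRel p`, `p ≥ 1`. -/
def relIdeal : Ideal (MvPolynomial ℕ+ ℤ) :=
  Ideal.span {f | ∃ p : ℕ, 1 ≤ p ∧ f = basicRel p}

/-- The ring `Γ`. -/
abbrev Gam : Type := MvPolynomial ℕ+ ℤ ⧸ relIdeal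

/-- The element `c_p` of `Γ`. -/
def c (p : ℕ) : Gam := Ideal.Quotient.mk relIdeal (cVar p)

/-- The polynomial ring `Γ[X_n] = Γ[x_1, …, x_n]`; the variable `x_i` is `X (i - 1)`. -/
abbrev GamX (n : ℕ) : Type := MvPolynomial (Fin n) Gam

/-- The element `ⁿc_p = ∑_{j=0}^p c_{p-j} e_j(X_n)` of `Γ[X_n]`. -/
def nc (n p : ℕ) : GamX n :=
  ∑ j ∈ Finset.range (p + 1), MvPolynomial.C (c (p - j)) * MvPolynomial.esymm (Fin n) Gam j

/-- The ring `Γ⁽ⁿ⁾ = ℤ[ⁿc_1, ⁿc_2, …]` of theta polynomials of level `n`, inside `Γ[X_n]`. -/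
def thetaRing (n : ℕ) : Subalgebra ℤ (GamX n) :=
  Algebra.adjoin ℤ {f | ∃ p : ℕ, 1 ≤ p ∧ f = nc n p}

/-- The set `𝒫_n` of strict partitions `λ = (λ_1 > ⋯ > λ_ℓ > 0)`, `ℓ ≥ 0`, with `λ_1 ≤ n`. -/
structure StrictPartitionLE (n : ℕ) where
  parts : List ℕ
  strictly_decreasing : parts.Pairwise (fun a b => a > b)
  parts_pos : ∀ p ∈ parts, 0 < p
  parts_le : ∀ p ∈ parts, p ≤ n

/-- The exponent vectors `α = (α_1, …, α_n)` with `0 ≤ α_i ≤ n - i` for `1 ≤ i ≤ n`; the entry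
`α_i` is `α (i - 1)`. -/
def ExponentVector (n : ℕ) : Type :=
  {α : Fin n → ℕ // ∀ i : Fin n, α i ≤ n - ((i : ℕ) + 1)}

/-- `e_p(-X_n)`: the elementary symmetric polynomial evaluated at `-x_1, …, -x_n`. -/
def eNeg (n p : ℕ) : GamX n :=
  MvPolynomial.aeval (fun i : Fin n => -(MvPolynomial.X i : GamX n))
    (MvPolynomial.esymm (Fin n) ℤ p)

/-- `e_λ(-X_n) = ∏_i e_{λ_i}(-X_n)`. -/
def eNegPart (n : ℕ) (l : StrictPartitionLE n) : GamX n :=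
  (l.parts.map (eNeg n)).prod

/-- The monomial `x^α = x_1^{α_1} ⋯ x_n^{α_n}`. -/
def xPow (n : ℕ) (α : ExponentVector n) : GamX n :=
  ∏ i : Fin n, MvPolynomial.X i ^ α.1 i

end SchubertC

end

noncomputable section

namespace SchubertC

/-! Write c(t), e(t), ⁿc(t) for the generating series of c_p, e_p(X_n), ⁿc_p. The relations of Γ say
c(t)c(-t) = 1, and ⁿc(t) = c(t)e(t), so ⁿc(t)ⁿc(-t) = e(t)e(-t) = ∏(1 - x_i²t²). Hence the ring U =
`evenRing n` ⊂ ℤ[X_n] generated by the coefficients of this product maps into Γ⁽ⁿ⁾.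

Moreover Γ[X_n] is the pushout of Γ⁽ⁿ⁾ and ℤ[X_n] over U (`exists_extension`, `adjoin_range_ofInt`):
from compatible maps on both, c(t) is recovered as ⁿc(t)/e(t), and compatibility over U forces
c(t)c(-t) = 1. By `exists_basis_of_pushout` it then suffices to find a basis of ℤ[X_n] over U.

There the products span (`span_basisElemInt`): Artin's monomials span over symmetric polynomials,
and e_p² can be straightened modulo U. They are 2ⁿ n! in number, as many as the signed permutations
of the variables, which fix U; Dedekind's independence of characters then makes them linearly
independent (`linearIndependent_of_span_of_algHom`). -/

/-- The quadratic expression `a_p ^ 2 + 2 ∑_{i=1}^p (-1)^i a_{p+i} a_{p-i}` in a sequence `a`. -/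
def quadRel {A : Type*} [CommRing A] (a : ℕ → A) (p : ℕ) : A :=
  a p ^ 2 + 2 * ∑ i ∈ Finset.Icc 1 p, (-1) ^ i * (a (p + i) * a (p - i))

/-! ### Quadratic relations as coefficients of a(t)a(-t) -/

section Quad

variable {A B : Type*} [CommRing A] [CommRing B]

theorem map_quadRel (f : A →+* B) (a : ℕ → A) (p : ℕ) :
    f (quadRel a p) = quadRel (fun k => f (a k)) p := by
  simp only [quadRel, map_add, map_mul, map_pow, map_sum, map_neg, map_one, map_ofNat]

theorem quadRel_zero (a : ℕ → A) : quadRel a 0 = a 0 ^ 2 := by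
  simp [quadRel]

theorem quadRel_neg_one_pow_mul (a : ℕ → A) (p : ℕ) :
    quadRel (fun k => (-1) ^ k * a k) p = quadRel a p := by
  have h : ∀ k : ℕ, ((-1 : A) ^ k) ^ 2 = 1 := fun k => by rw [← pow_mul]; simp
  unfold quadRel
  congr 1
  · rw [mul_pow, h, one_mul]
  · congr 1
    refine Finset.sum_congr rfl fun i hi => ?_
    have hi' := (Finset.mem_Icc.1 hi).2
    have : (-1 : A) ^ (p + i) * (-1) ^ (p - i) = 1 := by
      rw [← pow_add, show p + i + (p - i) = p * 2 by omega, pow_mul, h]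
    linear_combination ((-1) ^ i * a (p + i) * a (p - i)) * this

/-- The series `a(t) a(-t)`. -/
def normSeries (f : PowerSeries A) : PowerSeries A := f * PowerSeries.evalNegHom f

theorem normSeries_mul (f g : PowerSeries A) :
    normSeries (f * g) = normSeries f * normSeries g := by
  simp only [normSeries, map_mul]; ring

theorem coeff_normSeries (a : ℕ → A) (m : ℕ) :
    PowerSeries.coeff m (normSeries (PowerSeries.mk a)) =
      ∑ k ∈ Finset.range (m + 1), (-1) ^ (m - k) * (a k * a (m - k)) := by
  rw [normSeries, PowerSeries.coeff_mul, Finset.Nat.sum_antidiagonal_eq_sum_range_succ_mk]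
  refine Finset.sum_congr rfl fun k _ => ?_
  simp [PowerSeries.evalNegHom, PowerSeries.coeff_rescale]
  ring

/-- The terms k and 2p+1-k cancel in pairs, so no division by 2 is needed and the ring is arbitrary.
-/
theorem coeff_normSeries_odd (a : ℕ → A) (p : ℕ) :
    PowerSeries.coeff (2 * p + 1) (normSeries (PowerSeries.mk a)) = 0 := by
  rw [coeff_normSeries, show 2 * p + 1 + 1 = (p + 1) + (p + 1) by ring,
    Finset.sum_range_add, ← Finset.sum_range_reflect (fun x => _ * (a (p + 1 + x) * _)),
    ← Finset.sum_add_distrib]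
  refine Finset.sum_eq_zero fun k hk => ?_
  have hk' := Finset.mem_range.1 hk
  rw [show p + 1 + (p + 1 - 1 - k) = 2 * p + 1 - k by omega,
    show 2 * p + 1 - (2 * p + 1 - k) = k by omega]
  have : (-1 : A) ^ (2 * p + 1 - k) = - (-1) ^ k := by
    have h1 : (-1 : A) ^ (2 * p + 1 - k) * (-1) ^ k = -1 := by
      rw [← pow_add, show 2 * p + 1 - k + k = 2 * p + 1 by omega]; simp [pow_succ, pow_mul]
    have h2 : (-1 : A) ^ k * (-1) ^ k = 1 := by rw [← mul_pow]; simp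
    linear_combination (-1 : A) ^ k * h1 - (-1 : A) ^ (2 * p + 1 - k) * h2
  rw [this]; ring

/-- The terms p-i and p+i of the convolution agree, which gives the factor 2; the middle term is
a_p². -/
theorem coeff_normSeries_even (a : ℕ → A) (p : ℕ) :
    PowerSeries.coeff (2 * p) (normSeries (PowerSeries.mk a)) = (-1) ^ p * quadRel a p := by
  have h2 : ∀ k : ℕ, (-1 : A) ^ k * (-1) ^ k = 1 := fun k => by rw [← mul_pow]; simp
  have hI : ∀ f : ℕ → A, ∑ i ∈ Finset.Icc 1 p, f i = ∑ x ∈ Finset.range p, f (x + 1) := fun f => by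
    rw [Finset.range_eq_Ico, Finset.sum_Ico_add' f 0 p 1]; rfl
  rw [coeff_normSeries, show 2 * p + 1 = p + 1 + p by ring, Finset.sum_range_add,
    Finset.sum_range_succ, ← Finset.sum_range_reflect, quadRel, hI, two_mul p, Nat.add_sub_cancel,
    add_right_comm, ← Finset.sum_add_distrib, mul_add, Finset.mul_sum, Finset.mul_sum, add_comm]
  congr 1
  · ring
  · refine Finset.sum_congr rfl fun k hk => ?_
    have hk' := Finset.mem_range.1 hk
    rw [show p + p - (p - 1 - k) = p + (k + 1) by omega, show p - 1 - k = p - (k + 1) by omega,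
      show p + p - (p + 1 + k) = p - (k + 1) by omega, show p + 1 + k = p + (k + 1) by omega]
    have h3 : (-1 : A) ^ (p - (k + 1)) = (-1) ^ (p + (k + 1)) := by
      conv_rhs => rw [show p + (k + 1) = p - (k + 1) + ((k + 1) + (k + 1)) by omega, pow_add,
        pow_add _ (k + 1), h2, mul_one]
    rw [h3, pow_add]; ring

theorem normSeries_mk_congr (a b : ℕ → A) (h : ∀ p, quadRel a p = quadRel b p) :
    normSeries (PowerSeries.mk a) = normSeries (PowerSeries.mk b) := by
  ext m
  obtain ⟨p, rfl | rfl⟩ := m.even_or_odd'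
  · rw [coeff_normSeries_even, coeff_normSeries_even, h]
  · rw [coeff_normSeries_odd, coeff_normSeries_odd]

theorem quadRel_eq_coeff (a : ℕ → A) (p : ℕ) :
    quadRel a p = (-1) ^ p * PowerSeries.coeff (2 * p) (normSeries (PowerSeries.mk a)) := by
  rw [coeff_normSeries_even, ← mul_assoc, ← mul_pow]; simp

end Quad

/-! ### Independence from characters, and straightening of squares -/

/-- A relation among the b_j makes the square matrix (g_i(b_j)) singular. A left kernel vector v
gives ∑ v_i g_i = 0 on the b_j, hence on all of P by U-linearity, against Dedekind's theorem. -/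
theorem linearIndependent_of_span_of_algHom {U P ι : Type*} [Finite ι] [CommRing U] [CommRing P]
    [IsDomain P] [Algebra U P] [FaithfulSMul U P] (b : ι → P)
    (hb : Submodule.span U (Set.range b) = ⊤) (g : ι → P →ₐ[U] P) (hg : Function.Injective g) :
    LinearIndependent U b := by
  classical
  have := Fintype.ofFinite ι
  rw [Fintype.linearIndependent_iff]
  intro u hu
  by_contra! hne
  obtain ⟨i₀, hi₀⟩ := hne
  let M : Matrix ι ι P := fun i j => g i (b j)
  have hM : M.mulVec (fun j => algebraMap U P (u j)) = 0 := by
    ext i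
    have := congrArg (g i) hu
    simp only [map_sum, map_smul, map_zero] at this
    simpa [M, Matrix.mulVec, dotProduct, Algebra.smul_def, mul_comm] using this
  have hdet : M.det = 0 := by
    rw [← Matrix.exists_mulVec_eq_zero_iff]
    refine ⟨_, fun h0 => hi₀ ?_, hM⟩
    have := congrFun h0 i₀
    simpa using this
  obtain ⟨v, hv, hvM⟩ := Matrix.exists_vecMul_eq_zero_iff.2 hdet
  have key : ∀ y : P, ∑ i, v i * g i y = 0 := by
    intro y
    have hy : y ∈ Submodule.span U (Set.range b) := hb ▸ Submodule.mem_top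
    induction hy using Submodule.span_induction with
    | mem y h =>
      obtain ⟨j, rfl⟩ := h
      simpa [M, Matrix.vecMul, dotProduct] using congrFun hvM j
    | zero => simp
    | add y z _ _ h1 h2 => simp [mul_add, Finset.sum_add_distrib, h1, h2]
    | smul r y _ h =>
      simp only [map_smul, mul_smul_comm, ← Finset.smul_sum, h, smul_zero]
  have hli := (linearIndependent_monoidHom P P).comp (fun i => ((g i : P →* P)))
    (fun i j h => hg (by ext x; exact DFunLike.congr_fun h x))
  rw [Fintype.linearIndependent_iff] at hli
  refine hv (funext fun i => hli v ?_ i)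
  ext y
  simpa using key y

/-- A repeated part p is removed by rewriting e_p² as an element of U plus multiples of
e_{p+i}e_{p-i}, i ≥ 1, where indices above n contribute zero. -/
theorem prod_map_mem_span {U A : Type*} [CommRing U] [CommRing A] [Algebra U A] (e : ℕ → A) (n : ℕ)
    (he0 : e 0 = 1) (hn : ∀ p, n < p → e p = 0) (hU : ∀ p, ∃ u : U, algebraMap U A u = quadRel e p)
    (s : Multiset ℕ) (hs : ∀ p ∈ s, p ≤ n) :
    (s.map e).prod ∈ Submodule.span U {y | ∃ t : Multiset ℕ, t.Nodup ∧ (∀ p ∈ t, 0 < p ∧ p ≤ n) ∧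
      y = (t.map e).prod} := by
  -- Since (p+i)² + (p-i)² > 2p², spreading two equal parts lowers this weight; the +1 makes
  -- deleting any part, even one equal to n, lower it too.
  induction hw : (s.map fun j => n ^ 2 + 1 - j ^ 2).sum using Nat.strong_induction_on
    generalizing s with
  | _ w ih =>
  by_cases h0 : 0 ∈ s
  · obtain ⟨t, rfl⟩ := Multiset.exists_cons_of_mem h0
    simp only [Multiset.map_cons, Multiset.prod_cons, he0, one_mul]
    refine ih _ ?_ t (fun p hp => hs p (Multiset.mem_cons_of_mem hp)) rfl
    simp only [Multiset.map_cons, Multiset.sum_cons] at hw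
    omega
  by_cases hnd : s.Nodup
  · exact Submodule.subset_span ⟨s, hnd, fun p hp =>
      ⟨Nat.pos_of_ne_zero fun h => h0 (h ▸ hp), hs p hp⟩, rfl⟩
  obtain ⟨p, hp⟩ : ∃ p, p ::ₘ p ::ₘ 0 ≤ s := by
    by_contra! h
    exact hnd (Multiset.nodup_iff_le.2 fun a ha => h a ha)
  obtain ⟨t, rfl⟩ := Multiset.le_iff_exists_add.1 hp
  have hpn : p ≤ n := hs p (by simp)
  have ht : ∀ q ∈ t, q ≤ n := fun q hq => hs q (by simp [hq])
  have hp0 : 0 < p := Nat.pos_of_ne_zero fun h => h0 (by simp [h])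
  obtain ⟨u, hu⟩ := hU p
  have hpn2 : p ^ 2 ≤ n ^ 2 := Nat.pow_le_pow_left hpn 2
  simp only [Multiset.map_add, Multiset.map_cons, Multiset.map_zero, Multiset.sum_add,
    Multiset.sum_cons, Multiset.sum_zero] at hw
  have hred : (((p ::ₘ p ::ₘ 0) + t).map e).prod = u • (t.map e).prod -
      ∑ i ∈ Finset.Icc 1 p, (2 * (-1) ^ i : U) • (e (p + i) * (e (p - i) * (t.map e).prod)) := by
    have : e p ^ 2 = algebraMap U A u -
        2 * ∑ i ∈ Finset.Icc 1 p, (-1) ^ i * (e (p + i) * e (p - i)) := by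
      rw [hu, quadRel]; ring
    simp only [Multiset.map_add, Multiset.map_cons, Multiset.map_zero, Multiset.prod_add,
      Multiset.prod_cons, Multiset.prod_zero, Algebra.smul_def, map_mul, map_pow, map_neg, map_one,
      map_ofNat, mul_one]
    rw [← sq, this, sub_mul, Finset.mul_sum, Finset.sum_mul]
    congr 1
    exact Finset.sum_congr rfl fun i _ => by ring
  rw [hred]
  refine Submodule.sub_mem _ (Submodule.smul_mem _ _ (ih _ ?_ t ht rfl))
    (Submodule.sum_mem _ fun i hi => Submodule.smul_mem _ _ ?_)
  · omega
  · rw [Finset.mem_Icc] at hi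
    by_cases hpi : n < p + i
    · rw [hn _ hpi, zero_mul]; exact Submodule.zero_mem _
    · push Not at hpi
      have h1 : (p + i) ^ 2 + (p - i) ^ 2 = 2 * p ^ 2 + 2 * i ^ 2 := by
        obtain ⟨k, rfl⟩ := Nat.exists_eq_add_of_le hi.2
        rw [Nat.add_sub_cancel_left]; ring
      have h2 : 0 < i ^ 2 := by have := hi.1; positivity
      have h3 : (p + i) ^ 2 ≤ n ^ 2 := Nat.pow_le_pow_left hpi 2
      have h4 : (p - i) ^ 2 ≤ n ^ 2 := Nat.pow_le_pow_left (by omega) 2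
      have := ih _ ?_ ((p + i) ::ₘ (p - i) ::ₘ t) ?_ rfl
      · simpa using this
      · simp only [Multiset.map_cons, Multiset.sum_cons]
        omega
      · intro q hq
        simp only [Multiset.mem_cons] at hq
        rcases hq with rfl | rfl | hq
        · exact hpi
        · omega
        · exact ht q hq

/-! ### Artin's monomials span over the coefficients of ∏(X - x_i) -/

-- Division by a monic polynomial commutes with base change, so the quotient lifts even if `f` is
-- not injective.
open Polynomial in
theorem mem_lifts_of_X_sub_C_mul {R P : Type*} [CommRing R] [CommRing P] (f : R →+* P) (a : R)
    (g : P[X]) (h : (X - C (f a)) * g ∈ lifts f) : g ∈ lifts f := by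
  rw [mem_lifts] at h ⊢
  obtain ⟨q, hq⟩ := h
  refine ⟨q /ₘ (X - C a), ?_⟩
  rw [map_divByMonic _ (monic_X_sub_C a), hq, Polynomial.map_sub, map_X, map_C,
    mul_divByMonic_cancel_left _ (monic_X_sub_C _)]

section Artin

variable {S P : Type*} [CommRing S] [CommRing P] [Algebra S P] {n : ℕ}

/-- The subalgebra generated by the first `k` elements of the family `x`. -/
def adjoinLT (S : Type*) {P : Type*} [CommRing S] [CommRing P] [Algebra S P] {n : ℕ}
    (x : Fin n → P) (k : ℕ) : Subalgebra S P :=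
  Algebra.adjoin S (x '' {i | (i : ℕ) < k})

theorem mem_adjoinLT (x : Fin n → P) {k : ℕ} (i : Fin n) (hi : (i : ℕ) < k) :
    x i ∈ adjoinLT S x k :=
  Algebra.subset_adjoin ⟨i, hi, rfl⟩

open Polynomial in
theorem prod_X_sub_C_mem_lifts (x : Fin n → P)
    (hx : ∏ i, (X - C (x i)) ∈ lifts (algebraMap S P)) (k : ℕ) (hk : k ≤ n) :
    ∏ i ∈ Finset.univ.filter (fun i : Fin n => k ≤ (i : ℕ)), (X - C (x i)) ∈
      lifts (algebraMap (adjoinLT S x k) P) := by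
  induction k with
  | zero =>
    simp only [zero_le, Finset.filter_true]
    rw [lifts_iff_coeff_lifts] at hx ⊢
    intro m
    obtain ⟨s, hs⟩ := hx m
    exact ⟨algebraMap S _ s, hs⟩
  | succ k ih =>
    have hk' : k < n := hk
    refine mem_lifts_of_X_sub_C_mul _ ⟨x ⟨k, hk'⟩, mem_adjoinLT x _ (Nat.lt_succ_self k)⟩ _ ?_
    have hf : Finset.univ.filter (fun i : Fin n => k ≤ (i : ℕ)) =
        insert ⟨k, hk'⟩ (Finset.univ.filter (fun i : Fin n => k + 1 ≤ (i : ℕ))) := by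
      ext i
      simp only [Finset.mem_filter, Finset.mem_univ, true_and, Finset.mem_insert, Fin.ext_iff]
      omega
    have h := ih hk'.le
    rw [hf, Finset.prod_insert (by simp)] at h
    rw [lifts_iff_coeff_lifts] at h ⊢
    intro m
    obtain ⟨s, hs⟩ := h m
    refine ⟨⟨s.1, ?_⟩, hs⟩
    exact Algebra.adjoin_mono (Set.image_mono fun i hi => Nat.lt_succ_of_lt hi) s.2

theorem mem_adjoin_of_mem_adjoinLT_succ (x : Fin n → P) (k : Fin n) (y : P)
    (hy : y ∈ adjoinLT S x (k + 1)) : y ∈ Algebra.adjoin (adjoinLT S x k) {x k} := by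
  induction hy using Algebra.adjoin_induction with
  | mem y h =>
    obtain ⟨i, hi, rfl⟩ := h
    rcases Nat.lt_succ_iff_lt_or_eq.1 (show (i : ℕ) < k + 1 from hi) with h | h
    · exact Subalgebra.algebraMap_mem _ (⟨x i, mem_adjoinLT x i h⟩ : adjoinLT S x k)
    · rw [Fin.ext h]
      exact Algebra.subset_adjoin rfl
  | algebraMap r => exact Subalgebra.algebraMap_mem _ (algebraMap S (adjoinLT S x k) r)
  | add y z _ _ h1 h2 => exact add_mem h1 h2
  | mul y z _ _ h1 h2 => exact mul_mem h1 h2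

open Polynomial in
theorem mem_span_mul_pow_of_monic (B : Subalgebra S P) (q : B[X]) (hq : q.Monic) (a : P)
    (ha : aeval a q = 0) (y : P) (hy : y ∈ Algebra.adjoin B {a}) :
    y ∈ Submodule.span S {z | ∃ r ∈ B, ∃ j < q.natDegree, z = r * a ^ j} := by
  classical
  have hy' : y ∈ Subalgebra.toSubmodule (Algebra.adjoin B {a}) := hy
  rw [← Submodule.span_range_natDegree_eq_adjoin hq ha] at hy'
  -- Quantifying over `r` absorbs the `B`-scalars of the first span, so that the result is a span
  -- over `S`.
  refine Submodule.span_induction (p := fun y _ => ∀ r : B, r • y ∈ Submodule.span S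
    {z | ∃ r ∈ B, ∃ j < q.natDegree, z = r * a ^ j}) ?_ ?_ ?_ ?_ hy' 1 |> fun h => by
      rwa [one_smul] at h
  · intro y hy r
    simp only [Finset.coe_image, Set.mem_image, Finset.coe_range, Set.mem_Iio] at hy
    obtain ⟨j, hj, rfl⟩ := hy
    exact Submodule.subset_span ⟨r, r.2, j, hj, rfl⟩
  · intro r
    rw [smul_zero]; exact Submodule.zero_mem _
  · intro y z _ _ h1 h2 r
    rw [smul_add]; exact Submodule.add_mem _ (h1 r) (h2 r)
  · intro s y _ h r
    rw [smul_smul]; exact h _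

-- With zero-based indices, x_k is a root of ∏_{i≥k}(X - x_i), which is monic of degree n-k over the
-- algebra generated by the earlier variables. Hence only the powers up to n-(k+1) of x_k are
-- needed.
open Polynomial in
theorem adjoinLT_le_span [Nontrivial P] (x : Fin n → P)
    (hx : ∏ i, (X - C (x i)) ∈ lifts (algebraMap S P)) (k : ℕ) (hk : k ≤ n) (y : P)
    (hy : y ∈ adjoinLT S x k) : y ∈ Submodule.span S {y | ∃ α : Fin n → ℕ,
      (∀ i : Fin n, α i ≤ n - ((i : ℕ) + 1)) ∧ (∀ i : Fin n, k ≤ (i : ℕ) → α i = 0) ∧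
        y = ∏ i, x i ^ α i} := by
  classical
  induction k generalizing y with
  | zero =>
    have : adjoinLT S x 0 = ⊥ := by simp [adjoinLT]
    rw [this, Algebra.mem_bot] at hy
    obtain ⟨s, rfl⟩ := hy
    rw [Algebra.algebraMap_eq_smul_one]
    exact Submodule.smul_mem _ _ (Submodule.subset_span ⟨0, by simp, by simp, by simp⟩)
  | succ k ih =>
    have hk' : k < n := hk
    obtain ⟨q, hq, hdeg, hmon⟩ := lifts_and_natDegree_eq_and_monic
      (prod_X_sub_C_mem_lifts x hx k hk'.le) (monic_prod_of_monic _ _ fun i _ => monic_X_sub_C _)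
    have hroot : aeval (x ⟨k, hk'⟩) q = 0 := by
      rw [aeval_def, ← eval_map, hq, eval_prod]
      exact Finset.prod_eq_zero (i := ⟨k, hk'⟩) (by simp) (by simp)
    have hdeg' : q.natDegree ≤ n - k := by
      rw [hdeg, natDegree_prod_of_monic _ _ fun i _ => monic_X_sub_C _]
      simp only [natDegree_X_sub_C, Finset.sum_const, smul_eq_mul, mul_one]
      rw [← Nat.card_Ico]
      exact Finset.card_le_card_of_injOn (fun i => (i : ℕ)) (fun i hi => by simpa using hi)
        (fun i _ j _ h => Fin.ext h)
    have hy' := mem_span_mul_pow_of_monic _ q hmon _ hroot y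
      (mem_adjoin_of_mem_adjoinLT_succ x ⟨k, hk'⟩ y hy)
    refine Submodule.span_le.2 ?_ hy'
    rintro _ ⟨r, hr, j, hj, rfl⟩
    refine Submodule.span_induction (p := fun r _ => r * x ⟨k, hk'⟩ ^ j ∈ Submodule.span S _)
      ?_ ?_ ?_ ?_ (ih hk'.le r hr)
    · rintro _ ⟨α, h1, h2, rfl⟩
      refine Submodule.subset_span ⟨α + Pi.single ⟨k, hk'⟩ j, fun i => ?_, fun i hi => ?_, ?_⟩
      · by_cases h : i = ⟨k, hk'⟩
        · subst h
          simp only [Pi.add_apply, h2 ⟨k, hk'⟩ le_rfl, Pi.single_eq_same]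
          omega
        · simpa [h] using h1 i
      · have h : i ≠ ⟨k, hk'⟩ := fun h => by simp [h] at hi
        simpa [h] using h2 i (by omega)
      · simp only [Pi.add_apply, pow_add, Finset.prod_mul_distrib]
        congr 1
        rw [Finset.prod_eq_single ⟨k, hk'⟩] <;> simp +contextual
    · rw [zero_mul]; exact Submodule.zero_mem _
    · intro y z _ _ h1 h2
      rw [add_mul]; exact Submodule.add_mem _ h1 h2
    · intro s y _ h
      rw [smul_mul_assoc]; exact Submodule.smul_mem _ _ h

end Artin

/-! ### ℤ[X_n] over the invariants of signed permutations -/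

theorem mk_esymm_eq_prod (n : ℕ) (K : Type*) [CommRing K] :
    PowerSeries.mk (fun p => MvPolynomial.esymm (Fin n) K p) =
      ∏ i : Fin n, (1 + PowerSeries.C (MvPolynomial.X i) * PowerSeries.X) := by
  ext1 p
  rw [Finset.prod_one_add, map_sum, PowerSeries.coeff_mk, MvPolynomial.esymm,
    Finset.powersetCard_eq_filter, Finset.sum_filter]
  refine Finset.sum_congr rfl fun t _ => ?_
  rw [Finset.prod_mul_distrib, Finset.prod_const, ← map_prod, PowerSeries.coeff_C_mul_X_pow]
  simp only [eq_comm]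

theorem normSeries_mk_esymm (n : ℕ) (K : Type*) [CommRing K] :
    normSeries (PowerSeries.mk (fun p => MvPolynomial.esymm (Fin n) K p)) =
      ∏ i : Fin n, (1 - PowerSeries.C (MvPolynomial.X i ^ 2) * PowerSeries.X ^ 2) := by
  rw [normSeries, mk_esymm_eq_prod, map_prod, ← Finset.prod_mul_distrib]
  refine Finset.prod_congr rfl fun i _ => ?_
  have h : PowerSeries.evalNegHom (1 + PowerSeries.C (MvPolynomial.X i : MvPolynomial (Fin n) K) *
      PowerSeries.X) = 1 - PowerSeries.C (MvPolynomial.X i) * PowerSeries.X := by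
    have hC : PowerSeries.evalNegHom (PowerSeries.C (MvPolynomial.X i : MvPolynomial (Fin n) K)) =
        PowerSeries.C (MvPolynomial.X i) := by
      ext1 m
      rw [PowerSeries.evalNegHom, PowerSeries.coeff_rescale, PowerSeries.coeff_C]
      split_ifs with h <;> simp [h]
    rw [map_add, map_one, map_mul, hC, PowerSeries.evalNegHom_X, mul_neg, sub_eq_add_neg]
  rw [h, map_pow]
  ring

theorem esymm_eq_zero_of_lt (n : ℕ) (K : Type*) [CommRing K] {p : ℕ} (h : n < p) :
    MvPolynomial.esymm (Fin n) K p = 0 := by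
  rw [MvPolynomial.esymm, Finset.powersetCard_eq_empty.2 (by simpa using h), Finset.sum_empty]

/-- The elementary symmetric polynomial `e_p(-X_n)` with integer coefficients. -/
def eNegInt (n p : ℕ) : MvPolynomial (Fin n) ℤ :=
  (-1) ^ p * MvPolynomial.esymm (Fin n) ℤ p

theorem eNeg_eq_map (n p : ℕ) :
    eNeg n p = MvPolynomial.map (Int.castRingHom Gam) (eNegInt n p) := by
  rw [eNeg, eNegInt, map_mul, MvPolynomial.map_esymm, MvPolynomial.aeval_esymm_eq_multiset_esymm,
    MvPolynomial.esymm_eq_multiset_esymm, map_pow, map_neg, map_one]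
  convert! Multiset.esymm_neg (Finset.univ.val.map fun i : Fin n => (MvPolynomial.X i : GamX n)) p
  rw [Multiset.map_map]
  rfl

/-- The subring of `ℤ[X_n]` generated by the coefficients of `∏ (1 - x_i² t²)`. -/
def evenRing (n : ℕ) : Subalgebra ℤ (MvPolynomial (Fin n) ℤ) :=
  Algebra.adjoin ℤ (Set.range (quadRel (MvPolynomial.esymm (Fin n) ℤ)))

/-- The signed permutation `x_i ↦ ε_i x_{σ i}` of the variables. -/
def signedPerm (n : ℕ) (g : (Fin n → ℤˣ) × Equiv.Perm (Fin n)) :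
    MvPolynomial (Fin n) ℤ →ₐ[ℤ] MvPolynomial (Fin n) ℤ :=
  MvPolynomial.aeval fun i => MvPolynomial.C (g.1 i : ℤ) * MvPolynomial.X (g.2 i)

theorem signedPerm_injective (n : ℕ) : Function.Injective (signedPerm n) := by
  intro g h hgh
  have key : ∀ i, g.2 i = h.2 i ∧ g.1 i = h.1 i := fun i => by
    have := DFunLike.congr_fun hgh (MvPolynomial.X i)
    simp only [signedPerm, MvPolynomial.aeval_X, MvPolynomial.C_mul_X_eq_monomial] at this
    rw [MvPolynomial.monomial_eq_monomial_iff] at this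
    rcases this with ⟨h1, h2⟩ | ⟨h1, _⟩
    · exact ⟨Finsupp.single_left_injective one_ne_zero h1, Units.ext h2⟩
    · exact absurd h1 (g.1 i).ne_zero
  exact Prod.ext (funext fun i => (key i).2) (Equiv.ext fun i => (key i).1)

/-- Signs disappear in x_i², so a signed permutation merely permutes the factors 1 - x_i²t². -/
theorem signedPerm_quadRel (n : ℕ) (g : (Fin n → ℤˣ) × Equiv.Perm (Fin n)) (p : ℕ) :
    signedPerm n g (quadRel (MvPolynomial.esymm (Fin n) ℤ) p) =
      quadRel (MvPolynomial.esymm (Fin n) ℤ) p := by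
  have h : PowerSeries.map (signedPerm n g : MvPolynomial (Fin n) ℤ →+* MvPolynomial (Fin n) ℤ)
      (normSeries (PowerSeries.mk (fun p => MvPolynomial.esymm (Fin n) ℤ p))) =
      normSeries (PowerSeries.mk (fun p => MvPolynomial.esymm (Fin n) ℤ p)) := by
    rw [normSeries_mk_esymm, map_prod]
    refine Fintype.prod_equiv g.2 _ _ fun i => ?_
    have hs : (MvPolynomial.C (g.1 i : ℤ) : MvPolynomial (Fin n) ℤ) ^ 2 = 1 := by
      rw [← map_pow, ← Units.val_pow_eq_pow_val, Int.units_sq, Units.val_one, map_one]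
    have hg : (signedPerm n g : MvPolynomial (Fin n) ℤ →+* MvPolynomial (Fin n) ℤ)
        (MvPolynomial.X i ^ 2) = MvPolynomial.X (g.2 i) ^ 2 := by
      rw [AlgHom.coe_toRingHom, map_pow, signedPerm, MvPolynomial.aeval_X, mul_pow, hs, one_mul]
    rw [map_sub, map_one, map_mul, PowerSeries.map_C, hg, map_pow (PowerSeries.map _),
      PowerSeries.map_X]
  have := congrArg (PowerSeries.coeff (2 * p)) h
  rw [PowerSeries.coeff_map] at this
  rw [quadRel_eq_coeff, map_mul]
  simp only [map_pow, map_neg, map_one]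
  congr 1

/-- The signed permutation of the variables, as an endomorphism over `evenRing n`. -/
def signedPermEven (n : ℕ) (g : (Fin n → ℤˣ) × Equiv.Perm (Fin n)) :
    MvPolynomial (Fin n) ℤ →ₐ[evenRing n] MvPolynomial (Fin n) ℤ :=
  { (signedPerm n g : MvPolynomial (Fin n) ℤ →+* MvPolynomial (Fin n) ℤ) with
    commutes' := fun r => by
      have : evenRing n ≤ AlgHom.equalizer (signedPerm n g) (AlgHom.id ℤ _) :=
        Algebra.adjoin_le (by rintro _ ⟨p, rfl⟩; exact signedPerm_quadRel n g p)
      exact this r.2 }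

theorem signedPermEven_injective (n : ℕ) : Function.Injective (signedPermEven n) :=
  fun _ _ hgh => signedPerm_injective n (AlgHom.ext fun x => DFunLike.congr_fun hgh x)

/-- The subring of symmetric polynomials in `ℤ[X_n]`. -/
def symRing (n : ℕ) : Subalgebra ℤ (MvPolynomial (Fin n) ℤ) :=
  Algebra.adjoin ℤ (Set.range (eNegInt n))

theorem mem_span_of_mem_symRing (n : ℕ) (y : MvPolynomial (Fin n) ℤ) (hy : y ∈ symRing n) :
    y ∈ Submodule.span (evenRing n) {y | ∃ t : Multiset ℕ, t.Nodup ∧ (∀ p ∈ t, 0 < p ∧ p ≤ n) ∧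
      y = (t.map (eNegInt n)).prod} := by
  have hy' : y ∈ Subalgebra.toSubmodule (symRing n) := hy
  rw [symRing, Algebra.adjoin_eq_span] at hy'
  clear hy
  have hz : ∀ p, n < p → eNegInt n p = 0 := fun p hp => by
    rw [eNegInt, esymm_eq_zero_of_lt n ℤ hp, mul_zero]
  have key : ∀ s : Multiset ℕ, (s.map (eNegInt n)).prod ∈
      Submodule.span (evenRing n) {y | ∃ t : Multiset ℕ, t.Nodup ∧ (∀ p ∈ t, 0 < p ∧ p ≤ n) ∧
        y = (t.map (eNegInt n)).prod} := fun s => by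
    by_cases hs : ∀ p ∈ s, p ≤ n
    · refine prod_map_mem_span _ n (by simp [eNegInt]) hz (fun p => ?_) s hs
      refine ⟨⟨quadRel (MvPolynomial.esymm (Fin n) ℤ) p, Algebra.subset_adjoin ⟨p, rfl⟩⟩, ?_⟩
      exact (quadRel_neg_one_pow_mul _ p).symm
    · push Not at hs
      obtain ⟨p, hp, hpn⟩ := hs
      rw [Multiset.prod_eq_zero (Multiset.mem_map.2 ⟨p, hp, hz p hpn⟩)]
      exact Submodule.zero_mem _
  induction hy' using Submodule.span_induction with
  | zero => exact Submodule.zero_mem _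
  | add y z _ _ h1 h2 => exact Submodule.add_mem _ h1 h2
  | smul r y _ h => exact zsmul_mem h r
  | mem y h =>
    have : ∃ s : Multiset ℕ, y = (s.map (eNegInt n)).prod := by
      induction h using Submonoid.closure_induction with
      | one => exact ⟨0, by simp⟩
      | mem y h => obtain ⟨p, rfl⟩ := h; exact ⟨{p}, by simp⟩
      | mul y z _ _ h1 h2 =>
        obtain ⟨s, rfl⟩ := h1
        obtain ⟨t, rfl⟩ := h2
        exact ⟨s + t, by simp⟩
    obtain ⟨s, rfl⟩ := this
    exact key s

open Polynomial in
theorem prod_X_sub_C_mem_lifts_symRing (n : ℕ) :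
    ∏ i : Fin n, (X - C (MvPolynomial.X i : MvPolynomial (Fin n) ℤ)) ∈
      lifts (algebraMap (symRing n) (MvPolynomial (Fin n) ℤ)) := by
  have h := Multiset.prod_X_sub_X_eq_sum_esymm
    (Finset.univ.val.map fun i : Fin n => (MvPolynomial.X i : MvPolynomial (Fin n) ℤ))
  rw [Multiset.map_map] at h
  change ∏ i : Fin n, (X - C (MvPolynomial.X i : MvPolynomial (Fin n) ℤ)) = _ at h
  rw [h]
  refine Subsemiring.sum_mem _ fun j _ => ?_
  rw [← MvPolynomial.esymm_eq_multiset_esymm, ← mul_assoc]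
  refine Subsemiring.mul_mem _ ?_ (X_pow_mem_lifts _ _)
  have : (-1 : (MvPolynomial (Fin n) ℤ)[X]) ^ j * C (MvPolynomial.esymm (Fin n) ℤ j) =
      C (eNegInt n j) := by
    simp [eNegInt]
  rw [this]
  exact C_mem_lifts (algebraMap (symRing n) _) ⟨eNegInt n j, Algebra.subset_adjoin ⟨j, rfl⟩⟩

/-- The product `e_λ(-X_n) x^α` with integer coefficients. -/
def basisElemInt (n : ℕ) (i : StrictPartitionLE n × ExponentVector n) : MvPolynomial (Fin n) ℤ :=
  (i.1.parts.map (eNegInt n)).prod * ∏ j : Fin n, MvPolynomial.X j ^ i.2.1 j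

theorem span_basisElemInt (n : ℕ) :
    Submodule.span (evenRing n) (Set.range (basisElemInt n)) = ⊤ := by
  rw [eq_top_iff]
  intro y _
  have hy : y ∈ adjoinLT (symRing n) (fun i => (MvPolynomial.X i : MvPolynomial (Fin n) ℤ)) n := by
    induction y using MvPolynomial.induction_on with
    | C a => exact Subalgebra.algebraMap_mem _ (algebraMap ℤ (symRing n) a)
    | add p q h1 h2 => exact add_mem (h1 trivial) (h2 trivial)
    | mul_X p i h => exact mul_mem (h trivial) (mem_adjoinLT _ i i.2)
  have hy' := adjoinLT_le_span _ (prod_X_sub_C_mem_lifts_symRing n) n le_rfl y hy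
  clear hy
  -- The Artin coefficients lie in `symRing n`; carrying an arbitrary symmetric factor `r` lets each
  -- of them be straightened over `evenRing n`.
  refine Submodule.span_induction (p := fun y _ => ∀ r ∈ symRing n, r * y ∈
    Submodule.span (evenRing n) (Set.range (basisElemInt n))) ?_ ?_ ?_ ?_ hy' 1 (one_mem _) |>
      fun h => by rwa [one_mul] at h
  · rintro _ ⟨α, hα, -, rfl⟩ r hr
    refine Submodule.span_induction (p := fun r _ => r * _ ∈
      Submodule.span (evenRing n) (Set.range (basisElemInt n))) ?_ ?_ ?_ ?_
        (mem_span_of_mem_symRing n r hr)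
    · rintro _ ⟨t, ht, htn, rfl⟩
      refine Submodule.subset_span ⟨(⟨t.sort (· ≥ ·), ?_, ?_, ?_⟩, ⟨α, hα⟩), ?_⟩
      · have h1 := t.pairwise_sort (· ≥ ·)
        have h2 : (t.sort (· ≥ ·)).Nodup := by
          rw [← Multiset.coe_nodup, Multiset.sort_eq]; exact ht
        exact (h1.and h2).imp fun h => lt_of_le_of_ne h.1 (Ne.symm h.2)
      · exact fun p hp => (htn p ((Multiset.mem_sort _).1 hp)).1
      · exact fun p hp => (htn p ((Multiset.mem_sort _).1 hp)).2
      · simp only [basisElemInt]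
        rw [← Multiset.prod_coe, ← Multiset.map_coe, Multiset.sort_eq]
    · rw [zero_mul]; exact Submodule.zero_mem _
    · intro y z _ _ h1 h2
      rw [add_mul]; exact Submodule.add_mem _ h1 h2
    · intro s y _ h
      rw [smul_mul_assoc]; exact Submodule.smul_mem _ _ h
  · intro r _
    rw [mul_zero]; exact Submodule.zero_mem _
  · intro y z _ _ h1 h2 r hr
    rw [mul_add]; exact Submodule.add_mem _ (h1 r hr) (h2 r hr)
  · intro s y _ h r hr
    have : r * s • y = (r * s) * y := by rw [Algebra.smul_def, mul_assoc]; rfl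
    rw [this]
    exact h _ (mul_mem hr s.2)

/-- Strict partitions with parts at most `n` correspond to subsets of `{1, …, n}`. -/
def strictPartitionEquiv (n : ℕ) : StrictPartitionLE n ≃ (Finset.Icc 1 n).powerset where
  toFun l := ⟨l.parts.toFinset, by
    rw [Finset.mem_powerset]
    intro p hp
    rw [List.mem_toFinset] at hp
    exact Finset.mem_Icc.2 ⟨l.parts_pos p hp, l.parts_le p hp⟩⟩
  invFun s :=
    { parts := s.1.sort (· ≥ ·)
      strictly_decreasing := by
        exact ((s.1.pairwise_sort (· ≥ ·)).and (s.1.sort_nodup (· ≥ ·))).imp fun h =>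
          lt_of_le_of_ne h.1 (Ne.symm h.2)
      parts_pos := fun p hp =>
        (Finset.mem_Icc.1 (Finset.mem_powerset.1 s.2 ((Finset.mem_sort _).1 hp))).1
      parts_le := fun p hp =>
        (Finset.mem_Icc.1 (Finset.mem_powerset.1 s.2 ((Finset.mem_sort _).1 hp))).2 }
  left_inv l := by
    obtain ⟨parts, h, _, _⟩ := l
    simp only [StrictPartitionLE.mk.injEq]
    have hnd : parts.Nodup := h.imp fun h => h.ne'
    rw [List.toFinset_sort (· ≥ ·) hnd]
    exact h.imp fun h => h.le
  right_inv s := by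
    ext p
    simp

/-- Exponent vectors as a product of finite types. -/
def exponentVectorEquiv (n : ℕ) : ExponentVector n ≃ ((i : Fin n) → Fin (n - (i : ℕ))) where
  toFun α i := ⟨α.1 i, by have := α.2 i; have := i.2; omega⟩
  invFun f := ⟨fun i => f i, fun i => by have := (f i).2; dsimp only; omega⟩
  left_inv _ := rfl
  right_inv _ := rfl

theorem card_index (n : ℕ) :
    Nat.card (StrictPartitionLE n × ExponentVector n) = 2 ^ n * n.factorial := by
  rw [Nat.card_prod, Nat.card_congr (strictPartitionEquiv n),
    Nat.card_congr (exponentVectorEquiv n), Nat.card_pi]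
  congr 1
  · rw [Nat.card_eq_fintype_card, Fintype.card_coe, Finset.card_powerset, Nat.card_Icc,
      Nat.add_sub_cancel]
  · simp only [Nat.card_fin]
    rw [Fin.prod_univ_eq_prod_range (fun i => n - i), ← Nat.descFactorial_eq_prod_range,
      Nat.descFactorial_self]

instance (n : ℕ) : Finite (StrictPartitionLE n) := Finite.of_equiv _ (strictPartitionEquiv n).symm

instance (n : ℕ) : Finite (ExponentVector n) := Finite.of_equiv _ (exponentVectorEquiv n).symm

theorem linearIndependent_basisElemInt (n : ℕ) :
    LinearIndependent (evenRing n) (basisElemInt n) := by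
  have hcard : Nat.card (StrictPartitionLE n × ExponentVector n) =
      Nat.card ((Fin n → ℤˣ) × Equiv.Perm (Fin n)) := by
    rw [card_index, Nat.card_prod, Nat.card_perm, Nat.card_fun]
    simp
  exact linearIndependent_of_span_of_algHom _ (span_basisElemInt n)
    (fun i => signedPermEven n ((Finite.card_eq.1 hcard).some i))
    ((signedPermEven_injective n).comp (Equiv.injective _))

/-- The basis of `ℤ[X_n]` over `evenRing n`. -/
def basisInt (n : ℕ) : Module.Basis (StrictPartitionLE n × ExponentVector n) (evenRing n)
    (MvPolynomial (Fin n) ℤ) :=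
  Module.Basis.mk (linearIndependent_basisElemInt n) (span_basisElemInt n).ge

/-! ### Transport of a basis along a pushout -/

set_option maxSynthPendingDepth 3

open scoped TensorProduct

/-- Suppose that `G` is generated by `T` and `P`, and that ring homomorphisms from `T` and `P`
which agree on `U` extend to `G`. Then a basis of `P` over `U` becomes a basis of `G` over `T`. -/
theorem exists_basis_of_pushout {U P T G ι : Type} [CommRing U] [CommRing P] [CommRing T]
    [CommRing G] [Algebra U P] [Algebra T G] (b : Module.Basis ι U P) (f : P →+* G) (ψ : U →+* T)
    (hf : ∀ u, f (algebraMap U P u) = algebraMap T G (ψ u))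
    (hφ : ∀ (L : Type) [CommRing L] (i : T →+* L) (j : P →+* L),
      (∀ u, i (ψ u) = j (algebraMap U P u)) →
        ∃ φ : G →+* L, (∀ t, φ (algebraMap T G t) = i t) ∧ ∀ y, φ (f y) = j y)
    (hG : Algebra.adjoin T (Set.range f) = ⊤) :
    ∃ b' : Module.Basis ι T G, ∀ i, b' i = f (b i) := by
  let _ : Algebra U T := ψ.toAlgebra
  let _ : Algebra U G := ((algebraMap T G).comp ψ).toAlgebra
  have : IsScalarTower U T G := IsScalarTower.of_algebraMap_eq fun _ => rfl
  -- The extension property is needed only for the tensor product: it yields a left inverse of the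
  -- multiplication map `μ`, hence injectivity; generation gives surjectivity.
  obtain ⟨φ, hφT, hφP⟩ := hφ (T ⊗[U] P) (algebraMap T (T ⊗[U] P))
    (Algebra.TensorProduct.includeRight : P →ₐ[U] T ⊗[U] P).toRingHom fun u =>
      (IsScalarTower.algebraMap_apply U T (T ⊗[U] P) u).symm.trans
        ((Algebra.TensorProduct.includeRight : P →ₐ[U] T ⊗[U] P).commutes u).symm
  let f' : P →ₐ[U] G := { f with commutes' := hf }
  let μ : T ⊗[U] P →ₐ[T] G :=
    Algebra.TensorProduct.lift (Algebra.ofId T G) f' fun _ _ => Commute.all _ _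
  have hμ : ∀ y, μ (1 ⊗ₜ y) = f y := fun y => by
    simp [μ, Algebra.TensorProduct.lift_tmul]; rfl
  have hinj : Function.LeftInverse φ μ := fun z => by
    induction z using TensorProduct.induction_on with
    | zero => simp
    | add x y h1 h2 => rw [map_add, map_add, h1, h2]
    | tmul t y =>
      rw [Algebra.TensorProduct.lift_tmul, map_mul]
      change φ (algebraMap T G t) * φ (f y) = _
      rw [hφT, hφP]
      change (t ⊗ₜ 1) * (1 ⊗ₜ y) = t ⊗ₜ y
      rw [Algebra.TensorProduct.tmul_mul_tmul, mul_one, one_mul]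
  have hsurj : Function.Surjective μ := by
    rw [← AlgHom.range_eq_top, eq_top_iff, ← hG]
    refine Algebra.adjoin_le ?_
    rintro _ ⟨y, rfl⟩
    exact ⟨_, hμ y⟩
  refine ⟨(Algebra.TensorProduct.basis T b).map
    (LinearEquiv.ofBijective μ.toLinearMap ⟨hinj.injective, hsurj⟩), fun i => ?_⟩
  rw [Module.Basis.map_apply, Algebra.TensorProduct.basis_apply]
  exact hμ _

/-! ### The theta ring and its subring of even symmetric polynomials -/

theorem quadRel_c (p : ℕ) (hp : 1 ≤ p) : quadRel c p = 0 := by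
  have h : quadRel c p = Ideal.Quotient.mk relIdeal (basicRel p) :=
    (map_quadRel (Ideal.Quotient.mk relIdeal) cVar p).symm
  rw [h, Ideal.Quotient.eq_zero_iff_mem]
  exact Ideal.subset_span ⟨p, hp, rfl⟩

theorem c_zero : c 0 = 1 := by simp [c, cVar]

theorem normSeries_eq_one {A : Type*} [CommRing A] (a : ℕ → A) (h0 : a 0 = 1)
    (h : ∀ p, 1 ≤ p → quadRel a p = 0) : normSeries (PowerSeries.mk a) = 1 := by
  ext m
  obtain ⟨p, rfl | rfl⟩ := m.even_or_odd'
  · rw [coeff_normSeries_even]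
    rcases Nat.eq_zero_or_pos p with rfl | hp
    · simp [quadRel_zero, h0]
    · rw [h p hp, PowerSeries.coeff_one, if_neg (by omega), mul_zero]
  · rw [coeff_normSeries_odd, PowerSeries.coeff_one, if_neg (by omega)]

theorem mk_nc (n : ℕ) : PowerSeries.mk (nc n) =
    PowerSeries.mk (fun p => (MvPolynomial.C (c p) : GamX n)) *
      PowerSeries.mk (fun p => MvPolynomial.esymm (Fin n) Gam p) := by
  ext1 p
  rw [mul_comm, PowerSeries.coeff_mul, Finset.Nat.sum_antidiagonal_eq_sum_range_succ_mk]
  simp [nc, mul_comm]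

/-- The factor c(t)c(-t) of ⁿc(t)ⁿc(-t) equals 1. This identity is what places the image of
`evenRing n` inside `thetaRing n`. -/
theorem quadRel_nc (n p : ℕ) : quadRel (nc n) p = quadRel (MvPolynomial.esymm (Fin n) Gam) p := by
  rw [quadRel_eq_coeff, quadRel_eq_coeff, mk_nc, normSeries_mul, normSeries_eq_one, one_mul]
  · simp [c_zero]
  · intro p hp
    rw [← map_quadRel MvPolynomial.C c, quadRel_c p hp, map_zero]

theorem nc_zero (n : ℕ) : nc n 0 = 1 := by simp [nc, c_zero]

theorem nc_mem (n p : ℕ) : nc n p ∈ thetaRing n := by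
  rcases Nat.eq_zero_or_pos p with rfl | hp
  · rw [nc_zero]; exact one_mem _
  · exact Algebra.subset_adjoin ⟨p, hp, rfl⟩

theorem quadRel_mem {A : Type*} [CommRing A] (S : Subalgebra ℤ A) (a : ℕ → A)
    (h : ∀ p, a p ∈ S) (p : ℕ) : quadRel a p ∈ S :=
  add_mem (pow_mem (h p) 2) (mul_mem (ofNat_mem S 2) (sum_mem fun _ _ =>
    mul_mem (pow_mem (neg_mem (one_mem S)) _) (mul_mem (h _) (h _))))

/-- The inclusion `ℤ[X_n] → Γ[X_n]` on coefficients. -/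
def ofInt (n : ℕ) : MvPolynomial (Fin n) ℤ →+* GamX n :=
  MvPolynomial.map (Int.castRingHom Gam)

theorem ofInt_esymm (n p : ℕ) :
    ofInt n (MvPolynomial.esymm (Fin n) ℤ p) = MvPolynomial.esymm (Fin n) Gam p := by
  rw [ofInt, MvPolynomial.map_esymm]

theorem ofInt_quadRel (n p : ℕ) :
    ofInt n (quadRel (MvPolynomial.esymm (Fin n) ℤ) p) = quadRel (nc n) p := by
  rw [map_quadRel, quadRel_nc]
  simp only [ofInt_esymm]

theorem ofInt_mem_thetaRing (n : ℕ) (u : evenRing n) : ofInt n u ∈ thetaRing n := by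
  obtain ⟨u, hu⟩ := u
  change ofInt n u ∈ thetaRing n
  induction hu using Algebra.adjoin_induction with
  | mem y h =>
    obtain ⟨p, rfl⟩ := h
    rw [ofInt_quadRel]
    exact quadRel_mem _ _ (nc_mem n) p
  | algebraMap r =>
    rw [eq_intCast, map_intCast]
    exact intCast_mem _ r
  | add y z _ _ h1 h2 => rw [map_add]; exact add_mem h1 h2
  | mul y z _ _ h1 h2 => rw [map_mul]; exact mul_mem h1 h2

/-- The inclusion of `evenRing n` into the ring of theta polynomials. -/
def evenToTheta (n : ℕ) : evenRing n →+* thetaRing n :=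
  ((ofInt n).comp (algebraMap (evenRing n) _)).codRestrict (thetaRing n) (ofInt_mem_thetaRing n)

/-- The element `ⁿc_p` of the ring of theta polynomials. -/
def ncTheta (n p : ℕ) : thetaRing n := ⟨nc n p, nc_mem n p⟩

/-! ### Γ[X_n] as a pushout -/

section Pushout

variable {n : ℕ} {L : Type*} [CommRing L] (i : thetaRing n →+* L)
  (j : MvPolynomial (Fin n) ℤ →+* L)

/-- The generating series of the images of the elements `e_p(X_n)`. -/
def eSeries : PowerSeries L :=
  PowerSeries.mk fun p => j (MvPolynomial.esymm (Fin n) ℤ p)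

/-- The generating series of the images of the elements `ⁿc_p`. -/
def ncSeries : PowerSeries L :=
  PowerSeries.mk fun p => i (ncTheta n p)

theorem constantCoeff_eSeries : PowerSeries.constantCoeff (eSeries j) = 1 := by
  rw [← PowerSeries.coeff_zero_eq_constantCoeff_apply, eSeries, PowerSeries.coeff_mk,
    MvPolynomial.esymm_zero, map_one]

/-- The quotient of `ncSeries` by `eSeries`. -/
def cSeries : PowerSeries L :=
  ncSeries i * PowerSeries.invOfUnit (eSeries j) 1

theorem cSeries_mul : cSeries i j * eSeries j = ncSeries i := by
  rw [cSeries, mul_assoc, mul_comm (PowerSeries.invOfUnit _ _), PowerSeries.mul_invOfUnit, mul_one]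
  rw [constantCoeff_eSeries, Units.val_one]

theorem normSeries_ncSeries (h : ∀ u, i (evenToTheta n u) = j u) :
    normSeries (ncSeries i) = normSeries (eSeries j) := by
  refine normSeries_mk_congr _ _ fun p => ?_
  have h3 : quadRel (ncTheta n) p = evenToTheta n
      ⟨quadRel (MvPolynomial.esymm (Fin n) ℤ) p, Algebra.subset_adjoin ⟨p, rfl⟩⟩ :=
    Subtype.ext ((map_quadRel (thetaRing n).val.toRingHom (ncTheta n) p).trans
      (ofInt_quadRel n p).symm)
  rw [← map_quadRel i, h3, h, map_quadRel]

/-- The series of ⁿc and of e have equal norms, and the latter is a unit, so it cancels. -/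
theorem normSeries_cSeries (h : ∀ u, i (evenToTheta n u) = j u) :
    normSeries (cSeries i j) = 1 := by
  have hu : IsUnit (normSeries (eSeries j)) := by
    have : IsUnit (eSeries j) := by
      rw [PowerSeries.isUnit_iff_constantCoeff, constantCoeff_eSeries]; exact isUnit_one
    exact this.mul (this.map PowerSeries.evalNegHom)
  have h' := normSeries_mul (cSeries i j) (eSeries j)
  rw [cSeries_mul, normSeries_ncSeries i j h] at h'
  exact hu.mul_right_cancel (by rw [← h', one_mul])

theorem coeff_zero_cSeries : PowerSeries.coeff 0 (cSeries i j) = 1 := by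
  have h := congrArg PowerSeries.constantCoeff (cSeries_mul i j)
  rw [map_mul, constantCoeff_eSeries, mul_one] at h
  have h1 : ncTheta n 0 = 1 := Subtype.ext (nc_zero n)
  rw [PowerSeries.coeff_zero_eq_constantCoeff_apply, h,
    ← PowerSeries.coeff_zero_eq_constantCoeff_apply, ncSeries, PowerSeries.coeff_mk, h1, map_one]

/-- The ring homomorphism `ℤ[c] → L` given by the coefficients of `cSeries`. -/
def cHom : MvPolynomial ℕ+ ℤ →+* L :=
  MvPolynomial.eval₂Hom (Int.castRingHom _) fun p => PowerSeries.coeff p (cSeries i j)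

theorem cHom_cVar (p : ℕ) : cHom i j (cVar p) = PowerSeries.coeff p (cSeries i j) := by
  unfold cVar
  split_ifs with h
  · exact MvPolynomial.eval₂Hom_X' _ _ _
  · obtain rfl : p = 0 := by omega
    rw [map_one, coeff_zero_cSeries]

theorem cHom_eq_zero (h : ∀ u, i (evenToTheta n u) = j u) (f : MvPolynomial ℕ+ ℤ)
    (hf : f ∈ relIdeal) : cHom i j f = 0 := by
  have : relIdeal ≤ RingHom.ker (cHom i j) := Ideal.span_le.2 (by
    rintro _ ⟨p, hp, rfl⟩
    change cHom i j (quadRel cVar p) = 0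
    rw [map_quadRel]
    simp only [cHom_cVar]
    rw [quadRel_eq_coeff]
    have : PowerSeries.mk (fun k => PowerSeries.coeff k (cSeries i j)) = cSeries i j := by
      ext k; simp
    rw [this, normSeries_cSeries i j h, PowerSeries.coeff_one, if_neg (by omega), mul_zero])
  exact this hf

/-- The coefficients of `cSeries` satisfy the relations of Γ, so they define a map on Γ; together
with the images of the x_k it gives φ. Agreement with `i` on the generators ⁿc_p is the identity
`cSeries_mul`. -/
theorem exists_extension (h : ∀ u, i (evenToTheta n u) = j u) :
    ∃ φ : GamX n →+* L, (∀ t, φ (algebraMap (thetaRing n) (GamX n) t) = i t) ∧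
      ∀ y, φ (ofInt n y) = j y := by
  let γ : Gam →+* L := Ideal.Quotient.lift relIdeal (cHom i j) (cHom_eq_zero i j h)
  have hγ : ∀ p, γ (c p) = PowerSeries.coeff p (cSeries i j) := fun p => cHom_cVar i j p
  let φ : GamX n →+* L := MvPolynomial.eval₂Hom γ fun k => j (MvPolynomial.X k)
  have hφC : ∀ g, φ (MvPolynomial.C g) = γ g := fun g => MvPolynomial.eval₂Hom_C _ _ _
  have hφj : ∀ y, φ (ofInt n y) = j y := by
    have : φ.comp (ofInt n) = j := by
      refine MvPolynomial.ringHom_ext (fun a => ?_) fun k => ?_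
      · simp
      · rw [RingHom.comp_apply, ofInt, MvPolynomial.map_X]
        exact MvPolynomial.eval₂Hom_X' _ _ _
    exact fun y => DFunLike.congr_fun this y
  have hφnc : ∀ p, φ (nc n p) = i (ncTheta n p) := fun p => by
    have h' := congrArg (PowerSeries.coeff p) (cSeries_mul i j)
    rw [ncSeries, PowerSeries.coeff_mk] at h'
    rw [← h', mul_comm, PowerSeries.coeff_mul, Finset.Nat.sum_antidiagonal_eq_sum_range_succ_mk,
      nc, map_sum]
    refine Finset.sum_congr rfl fun k _ => ?_
    rw [map_mul, ← ofInt_esymm, hφj, hφC, hγ, mul_comm, eSeries, PowerSeries.coeff_mk]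
  refine ⟨φ, fun t => ?_, hφj⟩
  obtain ⟨t, ht⟩ := t
  change φ t = i ⟨t, ht⟩
  induction ht using Algebra.adjoin_induction with
  | mem y h =>
    obtain ⟨p, hp, rfl⟩ := h
    exact hφnc p
  | algebraMap r =>
    have : (⟨algebraMap ℤ (GamX n) r, (thetaRing n).algebraMap_mem r⟩ : thetaRing n) =
      (r : thetaRing n) := Subtype.ext (by simp)
    rw [this, eq_intCast, map_intCast, map_intCast]
  | add y z hy hz h1 h2 => rw [map_add, h1, h2, ← map_add]; rfl
  | mul y z hy hz h1 h2 => rw [map_mul, h1, h2, ← map_mul]; rfl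

end Pushout

/-- Solving the definition of ⁿc_p for its j = 0 term expresses c_p through ⁿc_p, the e_j and
smaller c's, so every c_p is reached by induction. -/
theorem adjoin_range_ofInt (n : ℕ) :
    Algebra.adjoin (thetaRing n) (Set.range (ofInt n)) = ⊤ := by
  set B := Algebra.adjoin (thetaRing n) (Set.range (ofInt n)) with hB
  have hint : ∀ y, ofInt n y ∈ B := fun y => Algebra.subset_adjoin ⟨y, rfl⟩
  have hc : ∀ p, MvPolynomial.C (c p) ∈ B := by
    intro p
    induction p using Nat.strong_induction_on with
    | _ p ih =>
      have h : MvPolynomial.C (c p) = nc n p - ∑ j ∈ Finset.range p,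
          MvPolynomial.C (c (p - (j + 1))) * MvPolynomial.esymm (Fin n) Gam (j + 1) := by
        rw [nc, Finset.sum_range_succ', MvPolynomial.esymm_zero, mul_one, Nat.sub_zero,
          add_sub_cancel_left]
      rw [h]
      refine B.sub_mem (B.algebraMap_mem ⟨nc n p, nc_mem n p⟩) (sum_mem fun j hj => ?_)
      rw [Finset.mem_range] at hj
      refine mul_mem (ih _ (by omega)) ?_
      have := hint (MvPolynomial.esymm (Fin n) ℤ (j + 1))
      rwa [ofInt_esymm] at this
  have hgam : ∀ g : Gam, MvPolynomial.C g ∈ B := by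
    intro g
    obtain ⟨g, rfl⟩ := Ideal.Quotient.mk_surjective g
    induction g using MvPolynomial.induction_on with
    | C a =>
      have := hint (MvPolynomial.C a)
      rw [ofInt, MvPolynomial.map_C] at this
      convert! this using 2
    | add p q h1 h2 => rw [map_add, map_add]; exact add_mem h1 h2
    | mul_X p i h =>
      rw [map_mul, map_mul]
      refine mul_mem h ?_
      have := hc i
      rwa [c, cVar, dif_pos i.pos] at this
  rw [eq_top_iff]
  intro y _
  induction y using MvPolynomial.induction_on with
  | C g => exact hgam g
  | add p q h1 h2 => exact add_mem (h1 trivial) (h2 trivial)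
  | mul_X p i h =>
    refine mul_mem (h trivial) ?_
    have := hint (MvPolynomial.X i)
    rwa [ofInt, MvPolynomial.map_X] at this

/-! ### The basis and the rank -/

theorem ofInt_basisElemInt (n : ℕ) (l : StrictPartitionLE n) (α : ExponentVector n) :
    ofInt n (basisElemInt n (l, α)) = eNegPart n l * xPow n α := by
  rw [basisElemInt, map_mul, map_list_prod, List.map_map, map_prod, eNegPart, xPow]
  congr 2
  · refine List.map_congr_left fun p _ => ?_
    exact (eNeg_eq_map n p).symm
  · simp [ofInt]

/-- Sending every c_p with p ≥ 1 to 0 respects the relations and maps Γ onto ℤ. Nontriviality is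
what lets the rank be read off from a basis in `rank_eq`. -/
instance : Nontrivial Gam := by
  refine Ideal.Quotient.nontrivial_iff.2 fun h => ?_
  have hle : relIdeal ≤ RingHom.ker
      (MvPolynomial.eval₂Hom (Int.castRingHom ℤ) fun _ : ℕ+ => (0 : ℤ)) := Ideal.span_le.2 (by
    rintro _ ⟨p, hp, rfl⟩
    have h0 : ∀ k, 1 ≤ k → MvPolynomial.eval₂Hom (Int.castRingHom ℤ) (fun _ : ℕ+ => (0 : ℤ))
        (cVar k) = 0 := fun k hk => by
      rw [cVar, dif_pos (show 0 < k from hk)]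
      exact MvPolynomial.eval₂Hom_X' _ _ _
    change MvPolynomial.eval₂Hom _ _ (quadRel cVar p) = 0
    rw [map_quadRel, quadRel, h0 p hp, Finset.sum_eq_zero]
    · simp
    · intro i _
      rw [h0 (p + i) (by omega), zero_mul, mul_zero])
  rw [h] at hle
  have := hle (show (1 : MvPolynomial ℕ+ ℤ) ∈ _ from trivial)
  rw [RingHom.mem_ker, map_one] at this
  exact one_ne_zero this

theorem exists_basis (n : ℕ) :
    ∃ b : Module.Basis (StrictPartitionLE n × ExponentVector n) (thetaRing n) (GamX n),
      ∀ l α, b (l, α) = eNegPart n l * xPow n α := by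
  obtain ⟨b, hb⟩ := exists_basis_of_pushout (T := thetaRing n) (G := GamX n) (basisInt n)
    (ofInt n) (evenToTheta n) (fun _ => rfl) (fun _ _ i j h => exists_extension i j h)
    (adjoin_range_ofInt n)
  refine ⟨b, fun l α => ?_⟩
  rw [hb, basisInt, Module.Basis.mk_apply, ofInt_basisElemInt]

theorem rank_eq (n : ℕ) :
    Module.rank (thetaRing n) (GamX n) = ((2 ^ n * Nat.factorial n : ℕ) : Cardinal) := by
  obtain ⟨b, -⟩ := exists_basis n
  rw [← b.mk_eq_rank'', ← card_index, Nat.cast_card]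

end SchubertC

theorem mainTheorem11 (n : ℕ) :
    Module.Free (SchubertC.thetaRing n) (SchubertC.GamX n) ∧
    Module.rank (SchubertC.thetaRing n) (SchubertC.GamX n) =
      ((2 ^ n * Nat.factorial n : ℕ) : Cardinal) ∧
    ∃ b : Module.Basis (SchubertC.StrictPartitionLE n × SchubertC.ExponentVector n)
        (SchubertC.thetaRing n) (SchubertC.GamX n),
      ∀ (l : SchubertC.StrictPartitionLE n) (α : SchubertC.ExponentVector n),
        b (l, α) = SchubertC.eNegPart n l * SchubertC.xPow n α := by
  obtain ⟨b, hb⟩ := SchubertC.exists_basis n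
  exact ⟨Module.Free.of_basis b, SchubertC.rank_eq n, b, hb⟩

end
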